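/- For a positive integer $p$ let $I_p=\sum_{k=1}^{p-1}\csc\left(\frac{k\pi}{p}\right)$ (so $I_1=0$). Let $\gamma$ be Euler's constant, let $(b_n)_{n\ge 0}$ be the Bernoulli numbers ($b_n=B_n(0)$, where $B_n$ is the $n$-th Bernoulli polynomial), and let $\eta(2k)=\sum_{j=1}^{\infty}\frac{(-1)^{j-1}}{j^{2k}}$ for $k\ge 1$. (1) For all integers $p\ge 2$ and $m\ge 1$ there is a real number $\varepsilon'_{p,m}$ with $0<\varepsilon'_{p,m}<|b_{2m}|$ such that \[ \pi I_p=2p\ln p+2\left(\gamma-\ln(\pi/2)\right)p-\sum_{k=1}^{m-1}\frac{2b_{2k}\,\eta(2k)}{k\,p^{2k-1}}+(-1)^m\frac{2\eta(2m)}{m\,p^{2m-1}}\,\varepsilon'_{p,m}. \] (2) For every integer $N\ge 0$, as $p\to\infty$, \[ I_p=\frac{2p}{\pi}\left(\ln p+\gamma-\ln(\pi/2)\right)+\sum_{k=1}^{N}(-1)^k\frac{(2^{2k}-2)\,b_{2k}^2}{k\cdot(2k)!}\left(\frac{\pi}{p}\right)^{2k-1}+O\!\left(\frac{1}{p^{2N+1}}\right).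 \] (3) For every integer $p\ge 1$ and every integer $n\ge 0$, \[ I_p<\frac{2p}{\pi}\left(\ln p+\gamma-\ln(\pi/2)\right)+\sum_{k=1}^{2n}(-1)^k\frac{(2^{2k}-2)\,b_{2k}^2}{k\cdot(2k)!}\left(\frac{\pi}{p}\right)^{2k-1} \] and \[ I_p>\frac{2p}{\pi}\left(\ln p+\gamma-\ln(\pi/2)\right)+\sum_{k=1}^{2n+1}(-1)^k\frac{(2^{2k}-2)\,b_{2k}^2}{k\cdot(2k)!}\left(\frac{\pi}{p}\right)^{2k-1}. \] (4) In particular, for every integer $p\ge 1$, \[ \frac{2p}{\pi}\left(\ln p+\gamma-\ln(\pi/2)\right)-\frac{\pi}{36p}<I_p<\frac{2p}{\pi}\left(\ln p+\gamma-\ln(\pi/2)\right). \] -/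

import Mathlib

open scoped Asymptotics

/-- The sum of cosecants `I_p = ∑_{k=1}^{p-1} 1 / sin (k π / p)` (empty, hence `0`, for `p = 1`). -/
noncomputable def cscSum (p : ℕ) : ℝ :=
  ∑ k ∈ Finset.Ico 1 p, 1 / Real.sin ((k : ℝ) * Real.pi / (p : ℝ))

/-- `etaEven k = η(2k) = ∑_{j ≥ 1} (-1)^(j-1) / j^(2k)`, an absolutely convergent series for
`k ≥ 1`; the summation index is shifted by one. -/
noncomputable def etaEven (k : ℕ) : ℝ :=
  ∑' j : ℕ, (-1 : ℝ) ^ j / ((j : ℝ) + 1) ^ (2 * k)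

/-- The main term `(2p/π) (ln p + γ - ln (π/2))`. -/
noncomputable def cscMain (p : ℕ) : ℝ :=
  2 * (p : ℝ) / Real.pi *
    (Real.log (p : ℝ) + Real.eulerMascheroniConstant - Real.log (Real.pi / 2))

/-- The `k`-th term `(-1)^k (2^(2k) - 2) b_{2k}^2 / (k (2k)!) (π/p)^(2k-1)` of the expansion
(used for `k ≥ 1`). -/
noncomputable def cscTerm (p k : ℕ) : ℝ :=
  (-1 : ℝ) ^ k * (((2 : ℝ) ^ (2 * k) - 2) * (bernoulli (2 * k) : ℝ) ^ 2) /
    ((k : ℝ) * (Nat.factorial (2 * k) : ℝ)) * (Real.pi / (p : ℝ)) ^ (2 * k - 1)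

section

open Filter Topology MeasureTheory Set

/-! Partial fractions turn each cosecant into an alternating series. Summing over `k` collects the
`n`-th terms into a block of reciprocals `1/(np+k)`, so `π I_p` becomes an alternating sum of
differences of harmonic numbers `H_{np}` (`sum_Ico_csc_term`). Inserting `H_N = ln N + γ + 1/(2N) -
ρ_0(N)`, the logarithms form Wallis' product and give `ln(π/2)`, the term `1/(2N)` cancels exactly,
and `A_0(p) = ∑_{j≥1} (-1)^(j-1) ρ_0(jp)` is left (`pi_mul_cscSum_eq`).

Signs and bounds come from writing `ρ_m` as the Laplace transform of a positive kernel `K_m` with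
`K_m + K_{m+1}` a monomial. Each `ρ_m` is then positive and strictly decreasing, so its alternating
sum `A_m(p)` is positive, and `A_m + A_{m+1}` is an explicit multiple of `η(2m+2)`
(`alternatingRemainder_add_succ`). Iterating gives the expansion with error `(-1)^(m+1) 4p A_m(p)`,
where `A_m` lies strictly between `0` and that multiple. All four claims follow. -/

/-! ### The Binet kernels -/

/-- The positive frequencies `2π(k+1)`, the poles of the Binet kernel on the imaginary axis. -/
noncomputable def binetFreq (k : ℕ) : ℝ := 2 * Real.pi * ((k : ℝ) + 1)

lemma binetFreq_pos (k : ℕ) : 0 < binetFreq k := by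
  unfold binetFreq; positivity

/-- `(-1)^m b_{2m+2} / (2m+2)!`, which equals `2 ∑ 1 / (2π(k+1))^(2m+2)`. -/
noncomputable def bernCoeff (m : ℕ) : ℝ :=
  (-1 : ℝ) ^ m * (bernoulli (2 * (m + 1)) : ℝ) / (Nat.factorial (2 * (m + 1)) : ℝ)

lemma hasSum_zeta_succ (m : ℕ) :
    HasSum (fun k : ℕ => 1 / ((k : ℝ) + 1) ^ (2 * (m + 1)))
      ((-1 : ℝ) ^ m * 2 ^ (2 * m + 1) * Real.pi ^ (2 * (m + 1)) *
        bernoulli (2 * (m + 1)) / (Nat.factorial (2 * (m + 1)))) := by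
  have h := hasSum_zeta_nat (k := m + 1) (by omega)
  rw [← hasSum_nat_add_iff' 1] at h
  simp only [Finset.range_one, Finset.sum_singleton, Nat.cast_zero] at h
  rw [zero_pow (by omega), div_zero, sub_zero, show 2 * (m + 1) - 1 = 2 * m + 1 by omega,
    show m + 1 + 1 = m + 2 by omega, pow_add (-1 : ℝ) m 2] at h
  simpa using h

lemma hasSum_binetFreq (m : ℕ) :
    HasSum (fun k : ℕ => 2 / binetFreq k ^ (2 * (m + 1))) (bernCoeff m) := by
  have h := (hasSum_zeta_succ m).mul_left (2 / (2 * Real.pi) ^ (2 * (m + 1)))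
  convert! h using 1
  · ext k
    rw [binetFreq, mul_pow]; field_simp
  · rw [bernCoeff, mul_pow, show 2 * (m + 1) = 2 * m + 1 + 1 by ring, pow_succ (2 : ℝ) (2 * m + 1)]
    have := Real.pi_pos
    field_simp

/-- The kernel whose Laplace transform is the `m`-th remainder in Stirling's expansion of the
harmonic numbers. -/
noncomputable def binetKernel (m : ℕ) (t : ℝ) : ℝ :=
  ∑' k : ℕ, 2 * t ^ (2 * m + 1) / (binetFreq k ^ (2 * m) * (t ^ 2 + binetFreq k ^ 2))

lemma summable_binetKernel (m : ℕ) {t : ℝ} (ht : 0 < t) :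
    Summable fun k : ℕ =>
      2 * t ^ (2 * m + 1) / (binetFreq k ^ (2 * m) * (t ^ 2 + binetFreq k ^ 2)) := by
  refine Summable.of_nonneg_of_le (fun k => ?_) (fun k => ?_)
    ((hasSum_binetFreq m).summable.mul_left (t ^ (2 * m + 1)))
  · have := binetFreq_pos k; positivity
  · have := binetFreq_pos k
    rw [← mul_div_assoc, mul_comm]
    gcongr
    rw [show 2 * (m + 1) = 2 * m + 2 by ring, pow_add]
    gcongr
    nlinarith

lemma binetKernel_pos (m : ℕ) {t : ℝ} (ht : 0 < t) : 0 < binetKernel m t := by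
  refine (summable_binetKernel m ht).tsum_pos (fun k => ?_) 0 ?_
  · have := binetFreq_pos k; positivity
  · have := binetFreq_pos 0; positivity

/-- Termwise, with `f` the frequency, `1 + t²/f² = (t² + f²)/f²` cancels the denominator `t² + f²`;
the sum over `f^(-2m-2)` is then a zeta value. -/
lemma binetKernel_add_succ (m : ℕ) {t : ℝ} (ht : 0 < t) :
    binetKernel m t + binetKernel (m + 1) t = bernCoeff m * t ^ (2 * m + 1) := by
  unfold binetKernel
  rw [← (summable_binetKernel m ht).tsum_add (summable_binetKernel (m + 1) ht),
    ← (hasSum_binetFreq m).tsum_eq, ← tsum_mul_right]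
  refine tsum_congr fun k => ?_
  have := binetFreq_pos k
  rw [show 2 * (m + 1) = 2 * m + 2 by ring]
  field_simp
  ring

/-- This is the Mittag-Leffler expansion of `π cot(πz)` at `z = it/(2π)`, where `exp(2πiz) =
exp(-t)`. -/
lemma binetKernel_zero {t : ℝ} (ht : 0 < t) :
    binetKernel 0 t = (1 + Real.exp (-t)) / (1 - Real.exp (-t)) / 2 - 1 / t := by
  have hpi := Real.pi_pos
  have hpc : (Real.pi : ℂ) ≠ 0 := by exact_mod_cast hpi.ne'
  have htc : (t : ℂ) ≠ 0 := by exact_mod_cast ht.ne'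
  set z : ℂ := Complex.I * t / (2 * Real.pi) with hz
  have hzim : z.im = t / (2 * Real.pi) := by
    have : z = ((t / (2 * Real.pi) : ℝ) : ℂ) * Complex.I := by
      rw [hz]; push_cast; ring
    rw [this, Complex.im_ofReal_mul, Complex.I_im, mul_one]
  have hmem : z ∈ Complex.integerComplement := by
    rintro ⟨n, hn⟩
    have := congrArg Complex.im hn
    rw [hzim, Complex.intCast_im] at this
    have : 0 < t / (2 * Real.pi) := by positivity
    linarith
  have h := cot_series_rep' hmem
  have he : Complex.exp (2 * Real.pi * Complex.I * z) = ((Real.exp (-t) : ℝ) : ℂ) := by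
    rw [Complex.ofReal_exp, hz]
    congr 1
    field_simp
    rw [Complex.I_sq]; push_cast; ring
  have hexp : 1 - ((Real.exp (-t) : ℝ) : ℂ) ≠ 0 := by
    have : Real.exp (-t) < 1 := by rw [Real.exp_lt_one_iff]; linarith
    rw [← Complex.ofReal_one, ← Complex.ofReal_sub]
    exact_mod_cast (sub_pos.2 this).ne'
  rw [Complex.cot_pi_eq_exp_ratio, he] at h
  have hterm : ∀ n : ℕ, 1 / (z - (n + 1)) + 1 / (z + (n + 1)) =
      (-(2 * Real.pi * Complex.I)) *
        ((2 * t / (t ^ 2 + binetFreq n ^ 2) : ℝ) : ℂ) := by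
    intro n
    have hf := binetFreq_pos n
    have h3 : ((t ^ 2 + binetFreq n ^ 2 : ℝ) : ℂ) ≠ 0 := by
      have : 0 < t ^ 2 + binetFreq n ^ 2 := by positivity
      exact_mod_cast this.ne'
    have h1 : z - (n + 1) ≠ 0 := by
      intro h0
      have := congrArg Complex.im h0
      simp [hzim] at this
      rcases this with h | h
      all_goals linarith
    have h2 : z + (n + 1) ≠ 0 := by
      intro h0
      have := congrArg Complex.im h0
      simp [hzim] at this
      rcases this with h | h
      all_goals linarith
    have h4 : ((t ^ 2 + binetFreq n ^ 2 : ℝ) : ℂ) =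
        -(2 * Real.pi) ^ 2 * ((z - (n + 1)) * (z + (n + 1))) := by
      rw [hz, binetFreq]; push_cast; field_simp
      linear_combination (t : ℂ) ^ 2 * Complex.I_sq
    have h5 : (t : ℂ) = -Complex.I * (2 * Real.pi) * z := by
      rw [hz]; field_simp; rw [Complex.I_sq]; ring
    rw [Complex.ofReal_div, h4]
    push_cast
    rw [h5]
    field_simp
    rw [Complex.I_sq]; ring
  rw [tsum_congr hterm, tsum_mul_left, ← Complex.ofReal_tsum] at h
  have hk : binetKernel 0 t = ∑' n : ℕ, 2 * t / (t ^ 2 + binetFreq n ^ 2) := by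
    unfold binetKernel; simp
  rw [← hk] at h
  rw [← Complex.ofReal_inj]
  have h6 : ((binetKernel 0 t : ℝ) : ℂ) = -(1 / (2 * Real.pi * Complex.I)) *
      (-(2 * Real.pi * Complex.I) * ((binetKernel 0 t : ℝ) : ℂ)) := by
    field_simp
  rw [h6, ← h, hz]
  push_cast at hexp ⊢
  field_simp
  rw [Complex.I_sq]; ring

lemma bernCoeff_pos (m : ℕ) : 0 < bernCoeff m := by
  rw [← (hasSum_binetFreq m).tsum_eq]
  exact (hasSum_binetFreq m).summable.tsum_pos
    (fun k => by have := binetFreq_pos k; positivity) 0 (by have := binetFreq_pos 0; positivity)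

/-- The closed form for `m = 0` and the recursion in `m` avoid any uniform convergence argument.
Continuity serves only for measurability. -/
lemma continuousOn_binetKernel (m : ℕ) : ContinuousOn (binetKernel m) (Ioi 0) := by
  induction m with
  | zero =>
    refine ContinuousOn.congr ?_ fun t (ht : 0 < t) => binetKernel_zero ht
    have h1 : ∀ t ∈ Ioi (0 : ℝ), 1 - Real.exp (-t) ≠ 0 := fun t (ht : 0 < t) => by
      have : Real.exp (-t) < 1 := by rw [Real.exp_lt_one_iff]; linarith
      linarith
    have h2 : ∀ t ∈ Ioi (0 : ℝ), t ≠ 0 := fun t (ht : 0 < t) => ht.ne'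
    fun_prop (disch := assumption)
  | succ m ih =>
    refine ContinuousOn.congr (f := fun t => bernCoeff m * t ^ (2 * m + 1) - binetKernel m t) ?_
      fun t (ht : 0 < t) => by simp only [← binetKernel_add_succ m ht, add_sub_cancel_left]
    fun_prop

lemma binetKernel_le (m : ℕ) {t : ℝ} (ht : 0 < t) :
    binetKernel m t ≤ bernCoeff m * t ^ (2 * m + 1) := by
  rw [← binetKernel_add_succ m ht]
  linarith [binetKernel_pos (m + 1) ht]

/-! ### Laplace transforms and the remainders for harmonic numbers -/

lemma integrableOn_pow_mul_exp (n : ℕ) {x : ℝ} (hx : 0 < x) :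
    IntegrableOn (fun t : ℝ => t ^ n * Real.exp (-(x * t))) (Ioi 0) := by
  have h := integrableOn_rpow_mul_exp_neg_mul_rpow (p := 1) (s := n) (b := x)
    (by have : (0 : ℝ) ≤ n := by positivity
        linarith) one_pos hx
  simpa using h

lemma integral_pow_mul_exp (n : ℕ) {x : ℝ} (hx : 0 < x) :
    ∫ t in Ioi (0 : ℝ), t ^ n * Real.exp (-(x * t)) = (Nat.factorial n : ℝ) / x ^ (n + 1) := by
  have h := Real.integral_rpow_mul_exp_neg_mul_Ioi (a := (n : ℝ) + 1) (by positivity) hx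
  simp only [add_sub_cancel_right, Real.rpow_natCast, Real.Gamma_nat_eq_factorial] at h
  rw [h]
  norm_cast
  rw [one_div, inv_pow]; field_simp

/-- The `m`-th remainder in Stirling's expansion of the harmonic numbers, as a Laplace
transform. -/
noncomputable def binetRemainder (m : ℕ) (x : ℝ) : ℝ :=
  ∫ t in Ioi (0 : ℝ), binetKernel m t * Real.exp (-(x * t))

lemma integrableOn_binetKernel (m : ℕ) {x : ℝ} (hx : 0 < x) :
    IntegrableOn (fun t => binetKernel m t * Real.exp (-(x * t))) (Ioi 0) := by
  refine Integrable.mono' ((integrableOn_pow_mul_exp (2 * m + 1) hx).const_mul (bernCoeff m)) ?_ ?_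
  · refine ContinuousOn.aestronglyMeasurable ?_ measurableSet_Ioi
    have := continuousOn_binetKernel m
    fun_prop
  · refine (ae_restrict_iff' measurableSet_Ioi).2 (ae_of_all _ fun t (ht : 0 < t) => ?_)
    have := binetKernel_pos m ht
    rw [Real.norm_of_nonneg (by positivity), ← mul_assoc]
    gcongr
    exact binetKernel_le m ht

lemma setIntegral_Ioi_pos {f : ℝ → ℝ} (hf : IntegrableOn f (Ioi 0)) (h : ∀ t, 0 < t → 0 < f t) :
    0 < ∫ t in Ioi (0 : ℝ), f t := by
  rw [setIntegral_pos_iff_support_of_nonneg_ae _ hf]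
  · have : Function.support f ∩ Ioi 0 = Ioi 0 :=
      inter_eq_right.2 fun t (ht : 0 < t) => (h t ht).ne'
    rw [this]; simp
  · exact (ae_restrict_iff' measurableSet_Ioi).2 (ae_of_all _ fun t ht => (h t ht).le)

lemma binetRemainder_pos (m : ℕ) {x : ℝ} (hx : 0 < x) : 0 < binetRemainder m x :=
  setIntegral_Ioi_pos (integrableOn_binetKernel m hx) fun t ht => by
    have := binetKernel_pos m ht; positivity

lemma binetRemainder_lt (m : ℕ) {x y : ℝ} (hx : 0 < x) (hxy : x < y) :
    binetRemainder m y < binetRemainder m x := by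
  have hx' := integrableOn_binetKernel m hx
  have hy' := integrableOn_binetKernel m (hx.trans hxy)
  rw [← sub_pos, binetRemainder, binetRemainder, ← integral_sub hx' hy']
  refine setIntegral_Ioi_pos (hx'.sub hy') fun t ht => ?_
  have := binetKernel_pos m ht
  rw [← mul_sub]
  refine mul_pos this (sub_pos.2 (Real.exp_lt_exp.2 ?_))
  nlinarith

lemma binetRemainder_add_succ (m : ℕ) {x : ℝ} (hx : 0 < x) :
    binetRemainder m x + binetRemainder (m + 1) x =
      (-1 : ℝ) ^ m * (bernoulli (2 * (m + 1)) : ℝ) / ((2 * (m + 1) : ℝ) * x ^ (2 * (m + 1))) := by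
  rw [binetRemainder, binetRemainder, ← integral_add (integrableOn_binetKernel m hx)
    (integrableOn_binetKernel (m + 1) hx)]
  have : ∀ t ∈ Ioi (0 : ℝ), binetKernel m t * Real.exp (-(x * t)) +
      binetKernel (m + 1) t * Real.exp (-(x * t)) =
      bernCoeff m * (t ^ (2 * m + 1) * Real.exp (-(x * t))) := fun t ht => by
    rw [← add_mul, binetKernel_add_succ m ht, mul_assoc]
  rw [setIntegral_congr_fun measurableSet_Ioi this, integral_const_mul, integral_pow_mul_exp _ hx,
    bernCoeff, show 2 * (m + 1) = 2 * m + 1 + 1 by ring, Nat.factorial_succ]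
  have : ((2 * m + 1).factorial : ℝ) ≠ 0 := by positivity
  push_cast
  field_simp
  ring

lemma tendsto_binetRemainder (m : ℕ) : Tendsto (binetRemainder m) atTop (𝓝 0) := by
  have h : Tendsto (fun x : ℝ => (-1 : ℝ) ^ m * (bernoulli (2 * (m + 1)) : ℝ) /
      ((2 * (m + 1) : ℝ) * x ^ (2 * (m + 1)))) atTop (𝓝 0) :=
    Tendsto.const_div_atTop
      (Tendsto.const_mul_atTop (by positivity) (tendsto_pow_atTop (by omega))) _
  refine squeeze_zero' ?_ ?_ h
  · filter_upwards [eventually_gt_atTop 0] with x hx using (binetRemainder_pos m hx).le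
  · filter_upwards [eventually_gt_atTop 0] with x hx
    rw [← binetRemainder_add_succ m hx]
    linarith [binetRemainder_pos (m + 1) hx]

lemma integral_exp_sub_exp_div {x : ℝ} (hx : 0 < x)
    (hint : IntegrableOn (fun t => t⁻¹ * (Real.exp (-(x * t)) - Real.exp (-((x + 1) * t)))) (Ioi 0)) :
    ∫ t in Ioi (0 : ℝ), t⁻¹ * (Real.exp (-(x * t)) - Real.exp (-((x + 1) * t))) =
      Real.log ((x + 1) / x) := by
  have h := Frullani.integral_Ioi_eq (f := fun t : ℝ => Real.exp (-t)) (a := x) (b := x + 1)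
    (L := 1) (R := 0) ?_ hx (by linarith) ?_ ?_ (by simpa using hint)
  · simpa using h
  · exact (Continuous.locallyIntegrable (by fun_prop)).locallyIntegrableOn _
  · have : Continuous fun t : ℝ => Real.exp (-t) := by fun_prop
    simpa using (this.tendsto 0).mono_left nhdsWithin_le_nhds
  · exact Real.tendsto_exp_neg_atTop_nhds_zero

/-- The difference of exponentials supplies a factor `1 - exp(-t)`, which cancels the denominator in
the closed form of `K_0`; what remains is elementary plus a Frullani integral. -/
lemma binetRemainder_zero_sub {x : ℝ} (hx : 0 < x) :
    binetRemainder 0 x - binetRemainder 0 (x + 1) =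
      1 / (2 * x) + 1 / (2 * (x + 1)) - Real.log ((x + 1) / x) := by
  have hx1 : 0 < x + 1 := by linarith
  have i1 := integrableOn_binetKernel 0 hx
  have i2 := integrableOn_binetKernel 0 hx1
  have e1 := integrableOn_pow_mul_exp 0 hx
  have e2 := integrableOn_pow_mul_exp 0 hx1
  have v1 := integral_pow_mul_exp 0 hx
  have v2 := integral_pow_mul_exp 0 hx1
  simp only [pow_zero, one_mul, Nat.factorial_zero, Nat.cast_one, zero_add, pow_one] at e1 e2 v1 v2
  have key : ∀ t ∈ Ioi (0 : ℝ), (Real.exp (-(x * t)) + Real.exp (-((x + 1) * t))) / 2 -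
      (binetKernel 0 t * Real.exp (-(x * t)) - binetKernel 0 t * Real.exp (-((x + 1) * t))) =
      t⁻¹ * (Real.exp (-(x * t)) - Real.exp (-((x + 1) * t))) := fun t (ht : 0 < t) => by
    have h1 : Real.exp (-((x + 1) * t)) = Real.exp (-(x * t)) * Real.exp (-t) := by
      rw [← Real.exp_add]; ring_nf
    have h2 : 1 - Real.exp (-t) ≠ 0 := by
      have : Real.exp (-t) < 1 := by rw [Real.exp_lt_one_iff]; linarith
      linarith
    rw [binetKernel_zero ht, h1]
    field_simp
    ring
  have e12 : IntegrableOn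
      (fun t => (Real.exp (-(x * t)) + Real.exp (-((x + 1) * t))) / 2) (Ioi 0) :=
    (e1.add e2).div_const 2
  have i12 : IntegrableOn (fun t => binetKernel 0 t * Real.exp (-(x * t)) -
      binetKernel 0 t * Real.exp (-((x + 1) * t))) (Ioi 0) := i1.sub i2
  have hF := integral_exp_sub_exp_div hx
    ((integrableOn_congr_fun (fun t ht => key t ht) measurableSet_Ioi).1 (e12.sub i12))
  rw [← setIntegral_congr_fun measurableSet_Ioi key, integral_sub e12 i12, integral_div,
    integral_add e1 e2, v1, v2, integral_sub i1 i2] at hF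
  change _ - (binetRemainder 0 x - binetRemainder 0 (x + 1)) = _ at hF
  have : (1 / x + 1 / (x + 1)) / 2 = 1 / (2 * x) + 1 / (2 * (x + 1)) := by field_simp
  linarith

/-- Binet's formula for the harmonic numbers. -/
lemma harmonic_eq_binetRemainder {N : ℕ} (hN : 1 ≤ N) :
    (harmonic N : ℝ) = Real.log N + Real.eulerMascheroniConstant + 1 / (2 * N) -
      binetRemainder 0 N := by
  -- The difference formula makes `e` constant from `1` on, and its limit is `γ`.
  let e : ℕ → ℝ := fun N => (harmonic N : ℝ) - Real.log N - (1 / 2) * (1 / (N : ℝ)) +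
    binetRemainder 0 N
  have hstep : ∀ n, 1 ≤ n → e (n + 1) = e n := by
    intro n hn
    have hn0 : (0 : ℝ) < n := by exact_mod_cast hn
    have h := binetRemainder_zero_sub hn0
    rw [Real.log_div (by positivity) (by positivity)] at h
    simp only [e, harmonic_succ]
    push_cast
    have h3 : (1 : ℝ) / (2 * n) = (1 / 2) * (1 / n) := by field_simp
    have h4 : (1 : ℝ) / (2 * (n + 1)) = (1 / 2) * (1 / (n + 1)) := by field_simp
    rw [h3, h4] at h
    rw [← one_div]
    linarith
  have hconst : ∀ n, N ≤ n → e n = e N := by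
    intro n hn
    induction n, hn using Nat.le_induction with
    | base => rfl
    | succ n hn ih => rw [hstep n (by omega), ih]
  have hlim : Tendsto e atTop (𝓝 (Real.eulerMascheroniConstant - (1 / 2) * 0 + 0)) :=
    (Real.tendsto_harmonic_sub_log.sub (tendsto_one_div_atTop_nhds_zero_nat.const_mul _)).add
      ((tendsto_binetRemainder 0).comp tendsto_natCast_atTop_atTop)
  have hlim' : Tendsto e atTop (𝓝 (e N)) :=
    tendsto_const_nhds.congr' (by
      filter_upwards [eventually_ge_atTop N] with n hn using (hconst n hn).symm)
  have h := tendsto_nhds_unique hlim' hlim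
  simp only [e] at h
  have h3 : (1 : ℝ) / (2 * N) = (1 / 2) * (1 / N) := by
    have : (N : ℝ) ≠ 0 := by positivity
    field_simp
  rw [h3]
  linarith

/-! ### Alternating sums of the remainders -/

lemma strictAnti_binetRemainder_mul (m : ℕ) {p : ℕ} (hp : 1 ≤ p) :
    StrictAnti fun j : ℕ => binetRemainder m (((j : ℝ) + 1) * p) := by
  intro i j hij
  have hp' : (0 : ℝ) < p := by exact_mod_cast hp
  have hij' : (i : ℝ) < j := by exact_mod_cast hij
  exact binetRemainder_lt m (by positivity) (by nlinarith)

lemma tendsto_binetRemainder_mul (m : ℕ) {p : ℕ} (hp : 1 ≤ p) :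
    Tendsto (fun j : ℕ => binetRemainder m (((j : ℝ) + 1) * p)) atTop (𝓝 0) := by
  have hp' : (0 : ℝ) < p := by exact_mod_cast hp
  refine (tendsto_binetRemainder m).comp (Tendsto.atTop_mul_const hp' ?_)
  exact tendsto_atTop_add_const_right _ _ tendsto_natCast_atTop_atTop

/-- The alternating sum `∑_{j ≥ 1} (-1)^(j-1) ρ_m(jp)` of the remainders `ρ_m`, a conditionally
convergent series. -/
noncomputable def alternatingRemainder (m p : ℕ) : ℝ :=
  limUnder atTop fun n : ℕ =>
    ∑ j ∈ Finset.range n, (-1 : ℝ) ^ j * binetRemainder m (((j : ℝ) + 1) * p)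

lemma tendsto_alternatingRemainder (m : ℕ) {p : ℕ} (hp : 1 ≤ p) :
    Tendsto (fun n : ℕ =>
      ∑ j ∈ Finset.range n, (-1 : ℝ) ^ j * binetRemainder m (((j : ℝ) + 1) * p)) atTop
      (𝓝 (alternatingRemainder m p)) :=
  tendsto_nhds_limUnder ((strictAnti_binetRemainder_mul m hp).antitone
    |>.tendsto_alternating_series_of_tendsto_zero (tendsto_binetRemainder_mul m hp))

/-- The limit is at least the sum of the first two terms, which is positive by strict monotonicity.
-/
lemma alternatingRemainder_pos (m : ℕ) {p : ℕ} (hp : 1 ≤ p) : 0 < alternatingRemainder m p := by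
  have hanti := strictAnti_binetRemainder_mul m hp
  have h := hanti.antitone.alternating_series_le_tendsto (tendsto_alternatingRemainder m hp) 1
  have h01 := hanti zero_lt_one
  simp only [mul_one, Finset.sum_range_succ, Finset.sum_range_zero, pow_zero, pow_one, one_mul,
    zero_add, neg_one_mul] at h h01
  linarith

lemma summable_etaEven (m : ℕ) :
    Summable fun j : ℕ => (-1 : ℝ) ^ j / ((j : ℝ) + 1) ^ (2 * (m + 1)) := by
  refine Summable.of_norm ?_
  refine (hasSum_zeta_succ m).summable.congr fun j => ?_
  rw [norm_div, norm_pow, norm_pow, norm_neg, norm_one, one_pow,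
    Real.norm_of_nonneg (by positivity : (0 : ℝ) ≤ (j : ℝ) + 1)]

lemma alternatingRemainder_add_succ (m : ℕ) {p : ℕ} (hp : 1 ≤ p) :
    alternatingRemainder m p + alternatingRemainder (m + 1) p =
      (-1 : ℝ) ^ m * (bernoulli (2 * (m + 1)) : ℝ) / ((2 * (m + 1) : ℝ) * (p : ℝ) ^ (2 * (m + 1))) *
        etaEven (m + 1) := by
  have hp' : (0 : ℝ) < p := by exact_mod_cast hp
  refine tendsto_nhds_unique
    ((tendsto_alternatingRemainder m hp).add (tendsto_alternatingRemainder (m + 1) hp)) ?_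
  refine ((summable_etaEven m).hasSum.tendsto_sum_nat.const_mul _).congr fun n => ?_
  rw [← Finset.sum_add_distrib, Finset.mul_sum]
  refine Finset.sum_congr rfl fun j _ => ?_
  rw [← mul_add, binetRemainder_add_succ m (by positivity : (0 : ℝ) < ((j : ℝ) + 1) * p), mul_pow]
  field_simp

/-! ### Partial fractions of the cosecant -/

lemma tendsto_pi_mul_cot {x : ℝ} (hx0 : 0 < x) (hx1 : x < 1) :
    Tendsto (fun M : ℕ => ∑ n ∈ Finset.range M, (1 / (x + n) - 1 / ((n : ℝ) + 1 - x))) atTop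
      (𝓝 (Real.pi * Real.cot (Real.pi * x))) := by
  have hmem : (x : ℂ) ∈ Complex.integerComplement := by
    rintro ⟨n, hn⟩
    have hn' : (n : ℝ) = x := by exact_mod_cast hn
    rw [← hn'] at hx0 hx1
    have h1 : 0 < n := by exact_mod_cast hx0
    have h2 : n < 1 := by exact_mod_cast hx1
    omega
  have hs := (summable_cotTerm hmem).hasSum
  simp only [cotTerm] at hs
  rw [← cot_series_rep' hmem] at hs
  have hs' : HasSum (fun n : ℕ => 1 / (x - (n + 1)) + 1 / (x + (n + 1)))
      (Real.pi * Real.cot (Real.pi * x) - 1 / x) := by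
    rw [← Complex.hasSum_ofReal]
    push_cast
    exact hs
  -- Replacing `1/(x+n+1)` by `1/(x+n)` in the partial sums adds `1/x` and removes this vanishing
  -- boundary term.
  have hinv : Tendsto (fun M : ℕ => 1 / (x + M)) atTop (𝓝 0) :=
    tendsto_const_nhds.div_atTop
      (tendsto_atTop_add_const_left _ _ tendsto_natCast_atTop_atTop)
  have h := (hs'.tendsto_sum_nat.add_const (1 / x)).sub hinv
  rw [sub_add_cancel, sub_zero] at h
  refine h.congr fun M => ?_
  induction M with
  | zero => simp
  | succ M ih =>
    rw [Finset.sum_range_succ, Finset.sum_range_succ, ← ih]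
    have : 1 / (x - ((M : ℝ) + 1)) = -(1 / ((M : ℝ) + 1 - x)) := by
      rw [← neg_sub, one_div_neg_eq_neg_one_div]
    rw [this]
    push_cast
    ring

/-- The partial fraction expansion of the cosecant. -/
lemma tendsto_pi_div_sin {x : ℝ} (hx0 : 0 < x) (hx1 : x < 1) :
    Tendsto (fun M : ℕ => ∑ n ∈ Finset.range (2 * M),
      (-1 : ℝ) ^ n * (1 / (x + n) + 1 / ((n : ℝ) + 1 - x))) atTop
      (𝓝 (Real.pi * (1 / Real.sin (Real.pi * x)))) := by
  -- With `y = πx/2`, `cot y + cot(π/2 - y) = 2 / sin(2y)`; the two cotangent series interleave into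
  -- one alternating series of even length.
  have h1 := tendsto_pi_mul_cot (x := x / 2) (by linarith) (by linarith)
  have h2 := tendsto_pi_mul_cot (x := (1 - x) / 2) (by linarith) (by linarith)
  have h := (h1.add h2).div_const 2
  have hval : (Real.pi * Real.cot (Real.pi * (x / 2)) +
      Real.pi * Real.cot (Real.pi * ((1 - x) / 2))) / 2 =
      Real.pi * (1 / Real.sin (Real.pi * x)) := by
    set y := Real.pi * (x / 2) with hy
    have hy0 : 0 < y := by have := Real.pi_pos; positivity
    have hy1 : y < Real.pi / 2 := by rw [hy]; nlinarith [Real.pi_pos]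
    have hs : 0 < Real.sin y := Real.sin_pos_of_pos_of_lt_pi hy0 (by linarith)
    have hc : 0 < Real.cos y := Real.cos_pos_of_mem_Ioo ⟨by linarith, hy1⟩
    rw [show Real.pi * ((1 - x) / 2) = Real.pi / 2 - y by rw [hy]; ring,
      show Real.pi * x = 2 * y by rw [hy]; ring, Real.cot_eq_cos_div_sin, Real.cot_eq_cos_div_sin,
      Real.cos_pi_div_two_sub, Real.sin_pi_div_two_sub, Real.sin_two_mul]
    field_simp
    linarith [Real.sin_sq_add_cos_sq y]
  rw [hval] at h
  refine h.congr fun M => ?_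
  rw [← Finset.sum_add_distrib]
  induction M with
  | zero => simp
  | succ M ih =>
    rw [Finset.sum_range_succ, add_div, ih, show 2 * (M + 1) = 2 * M + 1 + 1 by ring,
      Finset.sum_range_succ, Finset.sum_range_succ, pow_succ, pow_mul]
    have e1 : x / 2 + M = (x + (2 * M : ℕ)) / 2 := by push_cast; ring
    have e2 : (M : ℝ) + 1 - x / 2 = (((2 * M + 1 : ℕ) : ℝ) + 1 - x) / 2 := by push_cast; ring
    have e3 : (1 - x) / 2 + M = (((2 * M : ℕ) : ℝ) + 1 - x) / 2 := by push_cast; ring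
    have e4 : (M : ℝ) + 1 - (1 - x) / 2 = (x + (2 * M + 1 : ℕ)) / 2 := by push_cast; ring
    rw [e1, e2, e3, e4]
    simp only [one_div_div]
    ring

/-! ### Reduction to harmonic numbers and Wallis' product -/

lemma sum_one_div_eq_harmonic_sub (a q : ℕ) :
    ∑ k ∈ Finset.range q, 1 / ((a : ℝ) + k + 1) = (harmonic (a + q) : ℝ) - harmonic a := by
  induction q with
  | zero => simp
  | succ q ih =>
    rw [Finset.sum_range_succ, ih, ← add_assoc, harmonic_succ]
    push_cast
    ring

lemma sum_Ico_one_div_eq {p : ℕ} (hp : 1 ≤ p) (n : ℕ) :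
    ∑ k ∈ Finset.Ico 1 p, 1 / ((n : ℝ) * p + k) =
      (harmonic ((n + 1) * p) : ℝ) - 1 / (((n + 1 : ℕ) : ℝ) * p) - harmonic (n * p) := by
  obtain ⟨q, rfl⟩ : ∃ q, p = q + 1 := ⟨p - 1, by omega⟩
  rw [Finset.sum_Ico_eq_sum_range, add_tsub_cancel_right]
  have h := sum_one_div_eq_harmonic_sub (n * (q + 1)) q
  have h2 : (harmonic ((n + 1) * (q + 1)) : ℝ) =
      harmonic (n * (q + 1) + q) + 1 / (((n + 1 : ℕ) : ℝ) * (q + 1 : ℕ)) := by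
    rw [show (n + 1) * (q + 1) = n * (q + 1) + q + 1 by ring, harmonic_succ]
    push_cast
    rw [one_div]
    congr 2
    ring
  rw [h2, add_sub_cancel_right, ← h]
  refine Finset.sum_congr rfl fun k _ => ?_
  push_cast
  congr 1
  ring

/-- The reflection `k ↦ p - k` exchanges the two families of fractions, hence the factor `2`. -/
lemma sum_Ico_csc_term {p : ℕ} (hp : 1 ≤ p) (n : ℕ) :
    ∑ k ∈ Finset.Ico 1 p, (1 / ((k : ℝ) / p + n) + 1 / ((n : ℝ) + 1 - (k : ℝ) / p)) =
      2 * p * ((harmonic ((n + 1) * p) : ℝ) - 1 / (((n + 1 : ℕ) : ℝ) * p) - harmonic (n * p)) := by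
  have hp' : (p : ℝ) ≠ 0 := by positivity
  have hrefl : ∑ k ∈ Finset.Ico 1 p, 1 / ((n : ℝ) + 1 - (k : ℝ) / p) =
      ∑ k ∈ Finset.Ico 1 p, 1 / ((k : ℝ) / p + n) := by
    refine Finset.sum_nbij' (fun k => p - k) (fun k => p - k) ?_ ?_ ?_ ?_ ?_
    · intro k hk; simp only [Finset.mem_Ico] at hk ⊢; omega
    · intro k hk; simp only [Finset.mem_Ico] at hk ⊢; omega
    · intro k hk; simp only [Finset.mem_Ico] at hk; omega
    · intro k hk; simp only [Finset.mem_Ico] at hk; omega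
    · intro k hk
      simp only [Finset.mem_Ico] at hk
      rw [Nat.cast_sub hk.2.le, sub_div, div_self hp']
      congr 1
      ring
  rw [Finset.sum_add_distrib, hrefl, ← two_mul, ← sum_Ico_one_div_eq hp, mul_assoc,
    Finset.mul_sum _ _ (p : ℝ)]
  congr 1
  refine Finset.sum_congr rfl fun k _ => ?_
  rw [show (n : ℝ) * p + k = p * ((k : ℝ) / p + n) by field_simp; ring, mul_one_div,
    div_mul_cancel_left₀ hp', one_div]

lemma tendsto_alternating_harmonic {p : ℕ} (hp : 1 ≤ p) :
    Tendsto (fun M : ℕ => ∑ n ∈ Finset.range (2 * M), (-1 : ℝ) ^ n * (2 * p *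
      ((harmonic ((n + 1) * p) : ℝ) - 1 / (((n + 1 : ℕ) : ℝ) * p) - harmonic (n * p)))) atTop
      (𝓝 (Real.pi * cscSum p)) := by
  have hp' : (0 : ℝ) < p := by exact_mod_cast hp
  have h : Tendsto (fun M : ℕ => ∑ k ∈ Finset.Ico 1 p, ∑ n ∈ Finset.range (2 * M),
      (-1 : ℝ) ^ n * (1 / ((k : ℝ) / p + n) + 1 / ((n : ℝ) + 1 - (k : ℝ) / p))) atTop
      (𝓝 (∑ k ∈ Finset.Ico 1 p, Real.pi * (1 / Real.sin (Real.pi * ((k : ℝ) / p))))) := by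
    refine tendsto_finsetSum _ fun k hk => ?_
    simp only [Finset.mem_Ico] at hk
    have hk0 : (0 : ℝ) < k := by exact_mod_cast hk.1
    have hk1 : (k : ℝ) < p := by exact_mod_cast hk.2
    exact tendsto_pi_div_sin (by positivity) ((div_lt_one hp').2 hk1)
  rw [← Finset.mul_sum] at h
  have hc : cscSum p = ∑ k ∈ Finset.Ico 1 p, 1 / Real.sin (Real.pi * ((k : ℝ) / p)) := by
    refine Finset.sum_congr rfl fun k _ => ?_
    rw [mul_div_assoc', mul_comm Real.pi]
  rw [hc]
  refine h.congr fun M => ?_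
  rw [Finset.sum_comm]
  refine Finset.sum_congr rfl fun n _ => ?_
  rw [← Finset.mul_sum, sum_Ico_csc_term hp]

/-- Summation by parts: every interior `H` occurs twice with the same sign. Halving `c` inside is
what later cancels the `1/(2N)` of Binet's formula. -/
lemma sum_alternating_sub (H c : ℕ → ℝ) (M : ℕ) :
    ∑ n ∈ Finset.range (2 * M), (-1 : ℝ) ^ n * (H (n + 1) - c (n + 1) - H n) =
      2 * ∑ n ∈ Finset.range (2 * M), (-1 : ℝ) ^ n * (H (n + 1) - c (n + 1) / 2) +
        H (2 * M) - H 0 := by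
  induction M with
  | zero => simp
  | succ M ih =>
    rw [show 2 * (M + 1) = 2 * M + 1 + 1 by ring, Finset.sum_range_succ, Finset.sum_range_succ, ih,
      Finset.sum_range_succ _ (2 * M + 1), Finset.sum_range_succ _ (2 * M), pow_succ, pow_mul]
    ring

lemma log_wallis (M : ℕ) :
    Real.log (Real.Wallis.W M) =
      -2 * ∑ j ∈ Finset.range (2 * M), (-1 : ℝ) ^ j * Real.log ((j : ℝ) + 1) -
        Real.log (2 * M + 1) := by
  induction M with
  | zero => simp [Real.Wallis.W]
  | succ M ih =>
    have := Real.Wallis.W_pos M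
    rw [Real.Wallis.W_succ, Real.log_mul (by positivity) (by positivity),
      Real.log_mul (by positivity) (by positivity), Real.log_div (by positivity) (by positivity),
      Real.log_div (by positivity) (by positivity), ih, show 2 * (M + 1) = 2 * M + 1 + 1 by ring,
      Finset.sum_range_succ, Finset.sum_range_succ, pow_succ, pow_mul]
    push_cast
    rw [show (2 * (M : ℝ) + 1 + 1) = 2 * M + 2 by ring,
      show (2 * ((M : ℝ) + 1) + 1) = 2 * M + 3 by ring]
    norm_num
    ring

lemma sum_alternating_const (c : ℝ) (M : ℕ) :
    ∑ j ∈ Finset.range (2 * M), (-1 : ℝ) ^ j * c = 0 := by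
  rw [← Finset.sum_mul, neg_one_geom_sum, if_pos (even_two_mul M), zero_mul]

theorem pi_mul_cscSum_eq {p : ℕ} (hp : 1 ≤ p) :
    Real.pi * cscSum p = 2 * p * (Real.log p + Real.eulerMascheroniConstant -
      Real.log (Real.pi / 2) - 2 * alternatingRemainder 0 p) := by
  have hp' : (0 : ℝ) < p := by exact_mod_cast hp
  refine tendsto_nhds_unique (tendsto_alternating_harmonic hp) ?_
  have htwo : Tendsto (fun M : ℕ => 2 * M) atTop atTop :=
    tendsto_id.const_mul_atTop' (by norm_num)
  have hmul : Tendsto (fun M : ℕ => 2 * M * p) atTop atTop := htwo.atTop_mul_const' (by omega)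
  -- The boundary term `H_{2Mp}` grows like `ln(2Mp) + γ`; its growth in `M` is offset by the
  -- `-ln(2M+1)` accompanying Wallis' product, leaving `ln p + γ`.
  have t1 := Real.Wallis.tendsto_W_nhds_pi_div_two.log (by have := Real.pi_pos; positivity)
  have t2 := Real.tendsto_log_nat_add_one_sub_log.comp htwo
  have t3 := Real.tendsto_harmonic_sub_log.comp hmul
  have t4 := (tendsto_alternatingRemainder 0 hp).comp htwo
  have t := ((((t3.sub t1).sub t2).add_const (Real.log p)).sub (t4.const_mul 2)).const_mul
    (2 * (p : ℝ))
  rw [show Real.eulerMascheroniConstant - Real.log (Real.pi / 2) - 0 + Real.log p -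
      2 * alternatingRemainder 0 p = Real.log p + Real.eulerMascheroniConstant -
      Real.log (Real.pi / 2) - 2 * alternatingRemainder 0 p by ring] at t
  refine t.congr' ?_
  filter_upwards [eventually_ge_atTop 1] with M hM
  have hM' : (0 : ℝ) < M := by exact_mod_cast hM
  simp only [Function.comp_apply]
  have h1 : ∀ n : ℕ, (harmonic ((n + 1) * p) : ℝ) - 1 / (((n + 1 : ℕ) : ℝ) * p) / 2 =
      Real.log ((n : ℝ) + 1) + (Real.log p + Real.eulerMascheroniConstant) -
        binetRemainder 0 (((n : ℝ) + 1) * p) := by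
    intro n
    rw [harmonic_eq_binetRemainder (Nat.mul_pos n.succ_pos hp)]
    push_cast
    rw [Real.log_mul (by positivity) hp'.ne']
    field_simp
    ring
  have h2 := sum_alternating_sub (fun n => (harmonic (n * p) : ℝ)) (fun n => 1 / ((n : ℝ) * p)) M
  simp only [h1, mul_sub, mul_add, Finset.sum_add_distrib, Finset.sum_sub_distrib,
    sum_alternating_const, zero_mul, harmonic_zero, Rat.cast_zero] at h2
  simp only [mul_left_comm _ (2 * (p : ℝ)), ← Finset.mul_sum]
  congr 1
  simp only [mul_sub, Finset.sum_sub_distrib]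
  rw [h2, log_wallis]
  push_cast
  rw [Real.log_mul (by positivity) hp'.ne']
  ring

/-! ### Eta values and the expansion with signed remainder -/

/-- Changing the sign of the terms with even denominator base subtracts `2 · 2^(-s) ζ(s)` from
`ζ(s)`, where `s = 2(m+1)`. -/
lemma etaEven_succ (m : ℕ) :
    etaEven (m + 1) = (1 - 2 / 2 ^ (2 * (m + 1))) *
      ((-1 : ℝ) ^ m * 2 ^ (2 * m + 1) * Real.pi ^ (2 * (m + 1)) *
        bernoulli (2 * (m + 1)) / (Nat.factorial (2 * (m + 1)))) := by
  have hz := hasSum_zeta_succ m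
  set Z := (-1 : ℝ) ^ m * 2 ^ (2 * m + 1) * Real.pi ^ (2 * (m + 1)) *
        bernoulli (2 * (m + 1)) / (Nat.factorial (2 * (m + 1)))
  set s := 2 * (m + 1) with hs
  have hodd : HasSum (fun k : ℕ => 1 / (((2 * k + 1 : ℕ) : ℝ) + 1) ^ s) (1 / 2 ^ s * Z) := by
    refine (hz.mul_left (1 / 2 ^ s)).congr_fun fun k => ?_
    push_cast
    rw [show 2 * (k : ℝ) + 1 + 1 = 2 * (k + 1) by ring, mul_pow]
    field_simp
  have heven : Summable (fun k : ℕ => 1 / (((2 * k : ℕ) : ℝ) + 1) ^ s) :=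
    hz.summable.comp_injective (i := fun k => 2 * k) fun a b h => by
      simpa using h
  have hsum := (heven.hasSum.even_add_odd (f := fun k : ℕ => 1 / ((k : ℝ) + 1) ^ s) hodd).unique hz
  have h := (HasSum.even_add_odd (f := fun j : ℕ => (-1 : ℝ) ^ j / ((j : ℝ) + 1) ^ s)
    (heven.hasSum.congr_fun fun k => by rw [pow_mul]; simp)
    (hodd.neg.congr_fun fun k => by rw [pow_succ, pow_mul]; simp [neg_div])).tsum_eq
  rw [etaEven, ← hs, h]
  linear_combination hsum

lemma etaEven_pos (m : ℕ) : 0 < etaEven (m + 1) ∧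
    0 < (-1 : ℝ) ^ m * (bernoulli (2 * (m + 1)) : ℝ) := by
  have hb : 0 < (-1 : ℝ) ^ m * (bernoulli (2 * (m + 1)) : ℝ) := by
    have h := bernCoeff_pos m
    rw [bernCoeff] at h
    exact (div_pos_iff_of_pos_right (by positivity)).1 h
  refine ⟨?_, hb⟩
  -- At `p = 1` the product of `η(2m+2)` with a nonnegative factor is a sum of two positive
  -- remainders.
  have h := alternatingRemainder_add_succ m le_rfl
  have h1 := alternatingRemainder_pos m le_rfl
  have h2 := alternatingRemainder_pos (m + 1) le_rfl
  refine pos_of_mul_pos_right (h ▸ add_pos h1 h2) (div_nonneg hb.le (by positivity))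

/-- The expansion of `π I_p` with its remainder in terms of `alternatingRemainder`. -/
theorem pi_mul_cscSum_expansion {p : ℕ} (hp : 1 ≤ p) (m : ℕ) :
    Real.pi * cscSum p = 2 * (p : ℝ) * Real.log (p : ℝ)
      + 2 * (Real.eulerMascheroniConstant - Real.log (Real.pi / 2)) * (p : ℝ)
      - (∑ k ∈ Finset.Icc 1 m,
          2 * (bernoulli (2 * k) : ℝ) * etaEven k / ((k : ℝ) * (p : ℝ) ^ (2 * k - 1)))
      + (-1 : ℝ) ^ (m + 1) * (4 * p * alternatingRemainder m p) := by
  have hp' : (0 : ℝ) < p := by exact_mod_cast hp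
  induction m with
  | zero => rw [pi_mul_cscSum_eq hp]; simp; ring
  | succ m ih =>
    rw [ih, Finset.sum_Icc_succ_top (by omega)]
    have h := alternatingRemainder_add_succ m hp
    rw [← eq_sub_iff_add_eq] at h
    rw [h, show 2 * (m + 1) - 1 = 2 * m + 1 by omega]
    have h1 : (-1 : ℝ) ^ m * (-1) ^ m = 1 := by rw [← mul_pow]; norm_num
    have h2 : (-1 : ℝ) ^ (m + 1) * (4 * p * ((-1 : ℝ) ^ m * (bernoulli (2 * (m + 1)) : ℝ) /
        ((2 * (m + 1) : ℝ) * (p : ℝ) ^ (2 * (m + 1))) * etaEven (m + 1))) =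
        -(2 * (bernoulli (2 * (m + 1)) : ℝ) * etaEven (m + 1) /
          (((m + 1 : ℕ) : ℝ) * (p : ℝ) ^ (2 * m + 1))) := by
      rw [show 2 * (m + 1) = 2 * m + 1 + 1 by ring, pow_succ (p : ℝ)]
      push_cast
      field_simp
      rw [pow_succ]
      linear_combination
        (-4 * (bernoulli (2 * m + 1 + 1) : ℝ) * etaEven (m + 1)) * h1
    linear_combination h2

/-- Euler's evaluation of `η(2k)` contributes the second factor `b_{2k}`. -/
lemma cscTerm_eq {p : ℕ} (hp : 1 ≤ p) {k : ℕ} (hk : 1 ≤ k) :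
    cscTerm p k =
      -(2 * (bernoulli (2 * k) : ℝ) * etaEven k / ((k : ℝ) * (p : ℝ) ^ (2 * k - 1))) /
        Real.pi := by
  obtain ⟨m, rfl⟩ : ∃ m, k = m + 1 := ⟨k - 1, by omega⟩
  have hp' : (0 : ℝ) < p := by exact_mod_cast hp
  have := Real.pi_pos
  rw [cscTerm, etaEven_succ, show 2 * (m + 1) - 1 = 2 * m + 1 by omega, div_pow,
    show 2 * (m + 1) = 2 * m + 1 + 1 by ring, pow_succ Real.pi (2 * m + 1),
    pow_succ (2 : ℝ) (2 * m + 1), pow_succ (-1 : ℝ) m]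
  field_simp

lemma cscSum_sub_eq {p : ℕ} (hp : 1 ≤ p) (m : ℕ) :
    cscSum p - (cscMain p + ∑ k ∈ Finset.Icc 1 m, cscTerm p k) =
      (-1 : ℝ) ^ (m + 1) * (4 * p * alternatingRemainder m p / Real.pi) := by
  have hpi := Real.pi_pos
  have h := pi_mul_cscSum_expansion hp m
  rw [Finset.sum_congr rfl fun k hk => cscTerm_eq hp (Finset.mem_Icc.1 hk).1, ← Finset.sum_div,
    Finset.sum_neg_distrib, ← mul_right_inj' hpi.ne', cscMain]
  field_simp
  linear_combination h

lemma cscTerm_one {p : ℕ} (hp : 1 ≤ p) : cscTerm p 1 = -(Real.pi / (36 * p)) := by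
  have hp' : (0 : ℝ) < p := by exact_mod_cast hp
  have hb : bernoulli 2 = 1 / 6 := by
    rw [bernoulli_eq_bernoulli'_of_ne_one (by decide : 2 ≠ 1), bernoulli'_two]
  rw [cscTerm]
  norm_num [hb, Nat.factorial]
  field_simp

lemma cscSum_enclosure {p : ℕ} (hp : 1 ≤ p) (n : ℕ) :
    cscSum p < cscMain p + ∑ k ∈ Finset.Icc 1 (2 * n), cscTerm p k ∧
      cscMain p + ∑ k ∈ Finset.Icc 1 (2 * n + 1), cscTerm p k < cscSum p := by
  have hp' : (0 : ℝ) < p := by exact_mod_cast hp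
  have hpi := Real.pi_pos
  have h1 := cscSum_sub_eq hp (2 * n)
  have h2 := cscSum_sub_eq hp (2 * n + 1)
  have a1 := alternatingRemainder_pos (2 * n) hp
  have a2 := alternatingRemainder_pos (2 * n + 1) hp
  rw [Odd.neg_one_pow ⟨n, rfl⟩, neg_one_mul] at h1
  rw [Even.neg_one_pow ⟨n + 1, by ring⟩, one_mul] at h2
  have b1 : 0 < 4 * p * alternatingRemainder (2 * n) p / Real.pi := by positivity
  have b2 : 0 < 4 * p * alternatingRemainder (2 * n + 1) p / Real.pi := by positivity
  constructor <;> linarith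

lemma alternatingRemainder_lt (m : ℕ) {p : ℕ} (hp : 1 ≤ p) :
    alternatingRemainder m p <
      |(bernoulli (2 * (m + 1)) : ℝ)| / ((2 * (m + 1) : ℝ) * (p : ℝ) ^ (2 * (m + 1))) *
        etaEven (m + 1) := by
  have h : |(bernoulli (2 * (m + 1)) : ℝ)| = (-1 : ℝ) ^ m * (bernoulli (2 * (m + 1)) : ℝ) := by
    rw [← abs_of_pos (etaEven_pos m).2, abs_mul, abs_pow, abs_neg, abs_one, one_pow, one_mul]
  rw [h, ← alternatingRemainder_add_succ m hp]
  linarith [alternatingRemainder_pos (m + 1) hp]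

end

/-! ### The four claims -/

theorem corollary9p5 :
    -- expansion with explicit remainder
    (∀ p m : ℕ, 2 ≤ p → 1 ≤ m →
      ∃ ε : ℝ, 0 < ε ∧ ε < |(bernoulli (2 * m) : ℝ)| ∧
        Real.pi * cscSum p =
          2 * (p : ℝ) * Real.log (p : ℝ)
            + 2 * (Real.eulerMascheroniConstant - Real.log (Real.pi / 2)) * (p : ℝ)
            - (∑ k ∈ Finset.Icc 1 (m - 1),
                2 * (bernoulli (2 * k) : ℝ) * etaEven k / ((k : ℝ) * (p : ℝ) ^ (2 * k - 1)))
            + (-1 : ℝ) ^ m * (2 * etaEven m / ((m : ℝ) * (p : ℝ) ^ (2 * m - 1))) * ε) ∧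
    -- asymptotic expansion in powers of `1 / p`
    (∀ N : ℕ,
      (fun p : ℕ => cscSum p - (cscMain p + ∑ k ∈ Finset.Icc 1 N, cscTerm p k))
        =O[Filter.atTop] (fun p : ℕ => (1 / (p : ℝ)) ^ (2 * N + 1))) ∧
    -- truncations after an even number of terms are strict upper bounds, after an odd number
    -- of terms strict lower bounds
    (∀ p n : ℕ, 1 ≤ p →
      cscSum p < cscMain p + ∑ k ∈ Finset.Icc 1 (2 * n), cscTerm p k ∧
      cscMain p + ∑ k ∈ Finset.Icc 1 (2 * n + 1), cscTerm p k < cscSum p) ∧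
    -- the case `n = 0`
    (∀ p : ℕ, 1 ≤ p →
      cscMain p - Real.pi / (36 * (p : ℝ)) < cscSum p ∧ cscSum p < cscMain p) := by
  refine ⟨?_, ?_, fun p n hp => cscSum_enclosure hp n, fun p hp => ?_⟩
  · intro p m hp hm
    obtain ⟨m, rfl⟩ : ∃ k, m = k + 1 := ⟨m - 1, by omega⟩
    have hp1 : 1 ≤ p := by omega
    have hp' : (0 : ℝ) < p := by exact_mod_cast hp1
    have hη := (etaEven_pos m).1
    have hA := alternatingRemainder_pos m hp1
    have hlt := alternatingRemainder_lt m hp1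
    -- With `m` shifted by one, the witness solves `4p A_m = 2η(2m+2) ε / ((m+1) p^(2m+1))`.
    refine ⟨alternatingRemainder m p * (2 * (m + 1) * (p : ℝ) ^ (2 * (m + 1))) / etaEven (m + 1),
      by positivity, ?_, ?_⟩
    · rw [div_lt_iff₀ hη, ← lt_div_iff₀ (by positivity)]
      rwa [div_mul_eq_mul_div] at hlt
    · rw [add_tsub_cancel_right, pi_mul_cscSum_expansion hp1 m,
        show 2 * (m + 1) - 1 = 2 * m + 1 by omega,
        show 2 * (m + 1) = 2 * m + 1 + 1 by ring, pow_succ (p : ℝ) (2 * m + 1)]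
      push_cast
      field_simp
      ring
  · intro N
    refine Asymptotics.IsBigO.of_bound
      -- The constant is `4p/π` times the bound for `A_N(p)`, with `p^(-2N-1)` removed.
      (2 * |(bernoulli (2 * (N + 1)) : ℝ)| * etaEven (N + 1) / ((N + 1) * Real.pi)) ?_
    filter_upwards [Filter.eventually_ge_atTop 1] with p hp
    have hp' : (0 : ℝ) < p := by exact_mod_cast hp
    have hpi := Real.pi_pos
    have hA := alternatingRemainder_pos N hp
    have hlt := alternatingRemainder_lt N hp
    rw [cscSum_sub_eq hp, norm_mul, norm_pow, norm_neg, norm_one, one_pow, one_mul,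
      Real.norm_of_nonneg (by positivity), Real.norm_of_nonneg (by positivity)]
    calc 4 * p * alternatingRemainder N p / Real.pi
        ≤ 4 * p * (|(bernoulli (2 * (N + 1)) : ℝ)| /
          ((2 * (N + 1) : ℝ) * (p : ℝ) ^ (2 * (N + 1))) * etaEven (N + 1)) / Real.pi := by
          gcongr
      _ = _ := by
          rw [show 2 * (N + 1) = 2 * N + 1 + 1 by ring, pow_succ (p : ℝ) (2 * N + 1), one_div,
            inv_pow]
          field_simp
          ring
  · have h := cscSum_enclosure hp 0
    simp only [mul_zero, zero_add, Finset.Icc_self, Finset.sum_singleton, cscTerm_one hp,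
      Finset.Icc_eq_empty_of_lt zero_lt_one, Finset.sum_empty, add_zero] at h
    exact ⟨by linarith [h.2], h.1⟩
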